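/- Let $L$ be a frame, with pseudocomplement $a^*$. Write $a\prec b$ if $a^*\vee b=1$, and $a\prec\!\!\prec b$ if there is a family $(a_q)_{q\in\mathbb{Q}\cap[0,1]}$ in $L$ with $a_0=a$, $a_1=b$ and $a_p\prec a_q$ whenever $p<q$. The frame $L$ is completely regular if $a=\bigvee\{x\in L: x\prec\!\!\prec a\}$ for every $a\in L$. Let $BL=\{a\in L: a\vee a^*=1\}$ be the lattice of complemented elements of $L$; a frame is zero-dimensional if each of its elements is the join of the complemented elements below it. Let $\beta L$ (the Stone–Čech compactification) be the frame, ordered by inclusion, of the ideals $I$ of $L$ such that for every $a\in I$ there is $b\in I$ with $a\prec\!\!\prec b$, and let $\beta_0L$ (the Banaschewski compactification) be the frame of all ideals of $BL$, ordered by inclusion. The frame $L$ is strongly zero-dimensional if $\beta L$ is zero-dimensional. Let $\mathcal{R}L$ be the ring of continuous real-valued functions on $L$, i.e. of frame homomorphisms from the frame of reals (the frame $\mathfrak{O}\mathbb{R}$ of open subsets of $\mathbb{R}$) to $L$. For $\varphi\in\mathcal{R}L$ put $\operatorname{coz}\varphi=\varphi(-\infty,0)\vee\varphi(0,\infty)$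 and $R_\varphi=\{r\in\mathbb{R}:\operatorname{coz}(\varphi-\mathbf{r})\neq 1\}$, where $\mathbf{r}$ is the constant function with value $r$. Put $\operatorname{Coz}L=\{\operatorname{coz}\varphi:\varphi\in\mathcal{R}L\}$ and $\operatorname{Coz}_cL=\{\operatorname{coz}\varphi:\varphi\in\mathcal{R}L,\ R_\varphi\text{ is countable}\}$. **Theorem.** For every completely regular frame $L$, the following are equivalent: 1. $L$ is strongly zero-dimensional; 2. $\operatorname{Coz}L=\operatorname{Coz}_cL$; 3. $\beta L$ and $\beta_0L$ are isomorphic frames. -/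

import Mathlib

namespace PointfreeReals

open TopologicalSpace

universe u

section Relations

variable {L : Type u} [Order.Frame L]

/-- `a` is rather below `b`: `a* ∨ b = 1`, with `a*` the pseudocomplement of `a`. -/
def RatherBelow (a b : L) : Prop := aᶜ ⊔ b = ⊤

/-- `a` is completely below `b`: there is a family indexed by the rationals of `[0,1]`, from `a` to
`b`, along which `p < q` implies that the `p`-th member is rather below the `q`-th. -/
def CompletelyBelow (a b : L) : Prop :=
  ∃ s : Set.Icc (0 : ℚ) 1 → L, s 0 = a ∧ s 1 = b ∧ ∀ p q, p < q → RatherBelow (s p) (s q)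

theorem RatherBelow.mono {a a' b b' : L} (h : RatherBelow a b) (ha : a' ≤ a) (hb : b ≤ b') :
    RatherBelow a' b' :=
  top_le_iff.1 (h.ge.trans (sup_le_sup (compl_le_compl ha) hb))

theorem RatherBelow.sup {a a' b b' : L} (h : RatherBelow a b) (h' : RatherBelow a' b') :
    RatherBelow (a ⊔ a') (b ⊔ b') := by
  unfold RatherBelow at *
  rw [compl_sup, sup_inf_right]
  have h1 : aᶜ ⊔ (b ⊔ b') = ⊤ := by rw [← sup_assoc, h, top_sup_eq]
  have h2 : a'ᶜ ⊔ (b ⊔ b') = ⊤ := by rw [sup_left_comm, h', sup_top_eq]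
  rw [h1, h2, inf_top_eq]

theorem RatherBelow.inf {a a' b b' : L} (h : RatherBelow a b) (h' : RatherBelow a' b') :
    RatherBelow (a ⊓ a') (b ⊓ b') := by
  have h1 : RatherBelow (a ⊓ a') b := h.mono inf_le_left le_rfl
  have h2 : RatherBelow (a ⊓ a') b' := h'.mono inf_le_right le_rfl
  unfold RatherBelow at *
  rw [sup_inf_left, h1, h2, inf_top_eq]

theorem CompletelyBelow.sup {a a' b b' : L} (h : CompletelyBelow a b)
    (h' : CompletelyBelow a' b') : CompletelyBelow (a ⊔ a') (b ⊔ b') := by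
  obtain ⟨s, rfl, rfl, hs⟩ := h
  obtain ⟨t, rfl, rfl, ht⟩ := h'
  exact ⟨fun p => s p ⊔ t p, rfl, rfl, fun p q hpq => (hs p q hpq).sup (ht p q hpq)⟩

theorem CompletelyBelow.inf {a a' b b' : L} (h : CompletelyBelow a b)
    (h' : CompletelyBelow a' b') : CompletelyBelow (a ⊓ a') (b ⊓ b') := by
  obtain ⟨s, rfl, rfl, hs⟩ := h
  obtain ⟨t, rfl, rfl, ht⟩ := h'
  exact ⟨fun p => s p ⊓ t p, rfl, rfl, fun p q hpq => (hs p q hpq).inf (ht p q hpq)⟩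

theorem CompletelyBelow.mono {a a' b b' : L} (h : CompletelyBelow a b) (ha : a' ≤ a)
    (hb : b ≤ b') : CompletelyBelow a' b' := by
  obtain ⟨s, rfl, rfl, hs⟩ := h
  refine ⟨fun p => if p = 0 then a' else if p = 1 then b' else s p, if_pos rfl, ?_, ?_⟩
  · have h10 : (1 : Set.Icc (0 : ℚ) 1) ≠ 0 := fun h =>
      absurd (congrArg Subtype.val h) one_ne_zero
    exact (if_neg h10).trans (if_pos rfl)
  intro p q hpq
  have hq0 : q ≠ 0 := by rintro rfl; exact absurd hpq (not_lt.2 p.2.1)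
  have hp1 : p ≠ 1 := by rintro rfl; exact absurd hpq (not_lt.2 q.2.2)
  simp only [hq0, hp1, if_false]
  refine (hs p q hpq).mono ?_ ?_
  · split_ifs with h0
    · exact h0 ▸ ha
    · exact le_rfl
  · split_ifs with h1
    · exact h1 ▸ hb
    · exact le_rfl

theorem completelyBelow_bot : CompletelyBelow (⊥ : L) ⊥ :=
  ⟨fun _ => ⊥, rfl, rfl, fun _ _ _ => by simp [RatherBelow]⟩

theorem completelyBelow_top : CompletelyBelow (⊤ : L) ⊤ :=
  ⟨fun _ => ⊤, rfl, rfl, fun _ _ _ => by simp [RatherBelow]⟩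

end Relations

/-- A frame is completely regular if each `a` is the join of the elements completely below it. -/
def CompletelyRegular (L : Type u) [Order.Frame L] : Prop :=
  ∀ a : L, a = sSup {x | CompletelyBelow x a}

/-- A frame is zero-dimensional if each `a` is the join of the complemented elements below it. -/
def ZeroDimensional (L : Type u) [Order.Frame L] : Prop :=
  ∀ a : L, a = sSup {x | IsComplemented x ∧ x ≤ a}

section Ideals

/-- The ideals of a bounded distributive lattice form a frame under inclusion. -/
instance idealFrame (A : Type u) [DistribLattice A] [OrderBot A] : Order.Frame (Order.Ideal A) :=
  Order.Frame.ofMinimalAxioms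
    { (inferInstance : CompleteLattice (Order.Ideal A)) with
      inf_sSup_le_iSup_inf := by
        intro I S
        set K : Order.Ideal A := ⨆ J ∈ S, I ⊓ J with hK
        let T : Order.Ideal A :=
          { carrier := {x | ∀ a ∈ I, a ⊓ x ∈ K}
            lower' := fun x y hyx hx a ha => K.lower (inf_le_inf_left a hyx) (hx a ha)
            nonempty' := ⟨⊥, fun a _ => by rw [inf_bot_eq]; exact K.bot_mem⟩
            directed' := fun x hx y hy => ⟨x ⊔ y, fun a ha => by
              rw [inf_sup_left]; exact Order.Ideal.sup_mem (hx a ha) (hy a ha),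
              le_sup_left, le_sup_right⟩ }
        have hT : sSup S ≤ T := sSup_le fun J hJ x hx a ha => by
          have hle : I ⊓ J ≤ K := le_iSup₂_of_le J hJ le_rfl
          exact hle ⟨I.lower inf_le_left ha, J.lower inf_le_right hx⟩
        rintro x ⟨hxI, hxS⟩
        have := hT hxS x hxI
        rwa [inf_idem] at this }

variable {L : Type u} [Order.Frame L]

/-- An ideal `I` is completely regular if each of its elements is completely below another. -/
def IsCompletelyRegularIdeal (I : Order.Ideal L) : Prop :=
  ∀ a ∈ I, ∃ b ∈ I, CompletelyBelow a b

theorem IsCompletelyRegularIdeal.inf {I J : Order.Ideal L} (hI : IsCompletelyRegularIdeal I)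
    (hJ : IsCompletelyRegularIdeal J) : IsCompletelyRegularIdeal (I ⊓ J) := by
  rintro a ⟨haI, haJ⟩
  obtain ⟨b, hb, hab⟩ := hI a haI
  obtain ⟨c, hc, hac⟩ := hJ a haJ
  exact ⟨b ⊓ c, ⟨I.lower inf_le_left hb, J.lower inf_le_right hc⟩,
    (hab.inf hac).mono (le_inf le_rfl le_rfl) le_rfl⟩

theorem IsCompletelyRegularIdeal.sSup {S : Set (Order.Ideal L)}
    (hS : ∀ I ∈ S, IsCompletelyRegularIdeal I) : IsCompletelyRegularIdeal (sSup S) := by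
  let T : Order.Ideal L :=
    { carrier := {x | ∃ b ∈ SupSet.sSup S, CompletelyBelow x b}
      lower' := fun x y hyx ⟨b, hb, hxb⟩ => ⟨b, hb, hxb.mono hyx le_rfl⟩
      nonempty' := ⟨⊥, ⊥, Order.Ideal.bot_mem _, completelyBelow_bot⟩
      directed' := fun x ⟨b, hb, hxb⟩ y ⟨c, hc, hyc⟩ =>
        ⟨x ⊔ y, ⟨b ⊔ c, Order.Ideal.sup_mem hb hc, hxb.sup hyc⟩, le_sup_left, le_sup_right⟩ }
  have hT : SupSet.sSup S ≤ T := sSup_le fun I hI x hx => by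
    obtain ⟨b, hb, hxb⟩ := hS I hI x hx
    exact ⟨b, le_sSup hI hb, hxb⟩
  exact fun a ha => hT ha

theorem IsCompletelyRegularIdeal.top : IsCompletelyRegularIdeal (⊤ : Order.Ideal L) :=
  fun _ _ => ⟨⊤, trivial, completelyBelow_top.mono le_top le_rfl⟩

end Ideals

/-- The Stone-Čech compactification `βL`: the completely regular ideals of `L`, ordered by
inclusion. -/
def StoneCech (L : Type u) [Order.Frame L] : Type u :=
  {I : Order.Ideal L // IsCompletelyRegularIdeal I}

/-- The Banaschewski compactification `β₀L`: all ideals of the lattice of complemented elements of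
`L`, ordered by inclusion. -/
abbrev Banaschewski (L : Type u) [Order.Frame L] : Type u := Order.Ideal (Complementeds L)

namespace StoneCech

variable (L : Type u) [Order.Frame L]

instance : PartialOrder (StoneCech L) :=
  inferInstanceAs (PartialOrder {I : Order.Ideal L // IsCompletelyRegularIdeal I})

instance : SupSet (StoneCech L) :=
  ⟨fun S => ⟨sSup (Subtype.val '' S), IsCompletelyRegularIdeal.sSup (by
    rintro _ ⟨I, _, rfl⟩; exact I.2)⟩⟩

theorem isLUB_sSup' (S : Set (StoneCech L)) : IsLUB S (sSup S) := by
  constructor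
  · intro I hI
    exact le_sSup (a := I.1) (Set.mem_image_of_mem Subtype.val hI)
  · intro J hJ
    refine sSup_le (a := J.1) ?_
    rintro _ ⟨I, hI, rfl⟩
    exact hJ hI

/-- Joins and binary meets are those of the frame of all ideals of `L`. -/
instance : CompleteLattice (StoneCech L) :=
  { completeLatticeOfSup (StoneCech L) (isLUB_sSup' L) with
    inf := fun I J => ⟨I.1 ⊓ J.1, I.2.inf J.2⟩
    inf_le_left := fun I J => inf_le_left (a := I.1) (b := J.1)
    inf_le_right := fun I J => inf_le_right (a := I.1) (b := J.1)
    le_inf := fun _ _ _ h h' => le_inf (α := Order.Ideal L) h h'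
    top := ⟨⊤, IsCompletelyRegularIdeal.top⟩
    le_top := fun I => le_top (a := I.1) }

instance : Order.Frame (StoneCech L) :=
  Order.Frame.ofMinimalAxioms
    { (inferInstance : CompleteLattice (StoneCech L)) with
      inf_sSup_le_iSup_inf := by
        intro I S
        have h : I.1 ⊓ sSup (Subtype.val '' S) ≤ (⨆ J ∈ S, I ⊓ J : StoneCech L).1 := by
          rw [inf_sSup_eq]
          refine iSup₂_le ?_
          rintro _ ⟨J, hJ, rfl⟩
          exact le_iSup₂_of_le (f := fun (J : StoneCech L) (_ : J ∈ S) => I ⊓ J) J hJ le_rfl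
        exact h }

end StoneCech

/-- A frame is strongly zero-dimensional if its Stone-Čech compactification is zero-dimensional. -/
def StronglyZeroDimensional (L : Type u) [Order.Frame L] : Prop := ZeroDimensional (StoneCech L)

/-- The continuous real-valued functions on `L`: frame homomorphisms from the frame of reals,
realized as the frame of open subsets of `ℝ`, to `L`. -/
abbrev RealFun (L : Type u) [Order.Frame L] : Type u := FrameHom (Opens ℝ) L

namespace RealFun

variable {L : Type u} [Order.Frame L]

/-- The constant function `r`. -/
def const (L : Type u) [Order.Frame L] (r : ℝ) : RealFun L where
  toFun U := ⨆ _ : r ∈ U, ⊤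
  map_inf' U V := by
    change (⨆ _ : r ∈ U ∧ r ∈ V, (⊤ : L)) = _
    by_cases hU : r ∈ U <;> by_cases hV : r ∈ V <;> simp [hU, hV]
  map_top' := by simp
  map_sSup' S := by
    apply le_antisymm
    · refine iSup_le fun h => ?_
      obtain ⟨U, hU, hr⟩ := Opens.mem_sSup.1 h
      exact le_sSup_of_le (Set.mem_image_of_mem _ hU) (le_iSup_of_le hr le_rfl)
    · refine sSup_le ?_
      rintro _ ⟨U, hU, rfl⟩
      exact iSup_le fun h => le_iSup_of_le (Opens.mem_sSup.2 ⟨U, hU, h⟩) le_rfl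

/-- The value on `U` of the difference of `α` and `β`: the join of all `α V ∧ β W` for which
`v - w ∈ U` whenever `v ∈ V` and `w ∈ W`. -/
def subFun (α β : RealFun L) (U : Opens ℝ) : L :=
  ⨆ (V : Opens ℝ) (W : Opens ℝ) (_ : ∀ v ∈ V, ∀ w ∈ W, v - w ∈ U), α V ⊓ β W

theorem le_subFun (α β : RealFun L) {U V W : Opens ℝ} (h : ∀ v ∈ V, ∀ w ∈ W, v - w ∈ U) :
    α V ⊓ β W ≤ subFun α β U :=
  le_iSup_of_le V (le_iSup_of_le W (le_iSup_of_le h le_rfl))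

theorem subFun_mono (α β : RealFun L) {U U' : Opens ℝ} (h : U ≤ U') :
    subFun α β U ≤ subFun α β U' :=
  iSup_le fun _ => iSup_le fun _ => iSup_le fun hVW =>
    le_subFun α β fun v hv w hw => h (hVW v hv w hw)

theorem subFun_inf (α β : RealFun L) (U U' : Opens ℝ) :
    subFun α β (U ⊓ U') = subFun α β U ⊓ subFun α β U' := by
  apply le_antisymm
  · exact le_inf (subFun_mono α β inf_le_left) (subFun_mono α β inf_le_right)
  · conv_lhs => unfold subFun
    simp only [iSup_inf_eq, inf_iSup_eq]
    refine iSup_le fun V' => iSup_le fun W' => iSup_le fun h' => iSup_le fun V => iSup_le fun W =>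
      iSup_le fun h => ?_
    have : α V' ⊓ β W' ⊓ (α V ⊓ β W) ≤ α (V' ⊓ V) ⊓ β (W' ⊓ W) := by
      rw [map_inf, map_inf, inf_inf_inf_comm]
    rw [inf_comm]
    exact this.trans (le_subFun α β fun v hv w hw => ⟨h v hv.2 w hw.2, h' v hv.1 w hw.1⟩)

theorem subFun_top (α β : RealFun L) : subFun α β ⊤ = ⊤ := by
  refine top_le_iff.1 (le_trans ?_ (le_subFun α β (V := ⊤) (W := ⊤) fun _ _ _ _ => trivial))
  simp

theorem subFun_sSup_le (α β : RealFun L) (S : Set (Opens ℝ)) :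
    subFun α β (sSup S) ≤ sSup (subFun α β '' S) := by
  refine iSup_le fun V => iSup_le fun W => iSup_le fun h => ?_
  have hW : W ≤ sSup {W₀ : Opens ℝ | ∃ K : Set ℝ, IsCompact K ∧ (W₀ : Set ℝ) ⊆ K ∧ K ⊆ W} := by
    intro w hw
    obtain ⟨K, hK, hwK, hKW⟩ := exists_compact_subset W.isOpen hw
    exact Opens.mem_sSup.2 ⟨⟨interior K, isOpen_interior⟩, ⟨K, hK, interior_subset, hKW⟩, hwK⟩
  refine (inf_le_inf_left _ (OrderHomClass.mono β hW)).trans ?_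
  rw [map_sSup, inf_sSup_eq]
  refine iSup₂_le ?_
  rintro _ ⟨W₀, ⟨K, hK, hWK, hKW⟩, rfl⟩
  have hV : V ≤ sSup {A : Opens ℝ | α A ⊓ β W₀ ≤ sSup (subFun α β '' S)} := by
    intro x hx
    have key : ∃ A : Opens ℝ, x ∈ A ∧ ∃ B : Opens ℝ, K ⊆ B ∧
        α A ⊓ β B ≤ sSup (subFun α β '' S) := by
      refine hK.induction_on
        (p := fun s => ∃ A : Opens ℝ, x ∈ A ∧ ∃ B : Opens ℝ, s ⊆ B ∧
          α A ⊓ β B ≤ sSup (subFun α β '' S)) ?_ ?_ ?_ ?_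
      · exact ⟨⊤, trivial, ⊥, Set.empty_subset _, by simp⟩
      · rintro s t hst ⟨A, hA, B, hB, hAB⟩
        exact ⟨A, hA, B, hst.trans hB, hAB⟩
      · rintro s t ⟨A, hA, B, hB, hAB⟩ ⟨A', hA', B', hB', hAB'⟩
        refine ⟨A ⊓ A', ⟨hA, hA'⟩, B ⊔ B', ?_, ?_⟩
        · rw [Opens.coe_sup]; exact Set.union_subset_union hB hB'
        · rw [map_inf, map_sup, inf_sup_left]
          exact sup_le ((inf_le_inf_right _ inf_le_left).trans hAB)
            ((inf_le_inf_right _ inf_le_right).trans hAB')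
      · intro w hw
        obtain ⟨U, hU, hxw⟩ := Opens.mem_sSup.1 (h x hx w (hKW hw))
        have hc : Continuous fun z : ℝ × ℝ => z.1 - z.2 := continuous_fst.sub continuous_snd
        obtain ⟨A, B, hA, hB, hxA, hwB, hAB⟩ :=
          isOpen_prod_iff.1 (U.isOpen.preimage hc) x w hxw
        refine ⟨B, mem_nhdsWithin_of_mem_nhds (hB.mem_nhds hwB), ⟨A, hA⟩, hxA, ⟨B, hB⟩,
          subset_rfl, ?_⟩
        exact (le_subFun α β fun v hv w hw => hAB (Set.mk_mem_prod hv hw)).trans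
          (le_sSup (Set.mem_image_of_mem _ hU))
    obtain ⟨A, hxA, B, hKB, hAB⟩ := key
    exact Opens.mem_sSup.2 ⟨A, (inf_le_inf_left _
      (OrderHomClass.mono β (show W₀ ≤ B from hWK.trans hKB))).trans hAB, hxA⟩
  refine (inf_le_inf_right _ (OrderHomClass.mono α hV)).trans ?_
  rw [map_sSup, sSup_inf_eq]
  refine iSup₂_le ?_
  rintro _ ⟨A, hA, rfl⟩
  exact hA

/-- The difference of two continuous real-valued functions on `L`. -/
def sub (α β : RealFun L) : RealFun L where
  toFun := subFun α β
  map_inf' := subFun_inf α β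
  map_top' := subFun_top α β
  map_sSup' S := by
    refine le_antisymm (subFun_sSup_le α β S) (sSup_le ?_)
    rintro _ ⟨U, hU, rfl⟩
    exact subFun_mono α β (le_sSup hU)

/-- The cozero element `φ(-,0) ∨ φ(0,-)`. -/
def coz (φ : RealFun L) : L :=
  φ ⟨Set.Iio 0, isOpen_Iio⟩ ⊔ φ ⟨Set.Ioi 0, isOpen_Ioi⟩

/-- The pointfree image `R_α` of `α`: the reals `r` with `coz (α - r) ≠ 1`. -/
def image (α : RealFun L) : Set ℝ := {r | coz (sub α (const L r)) ≠ ⊤}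

end RealFun

/-- The cozero part `Coz L`. -/
def Coz (L : Type u) [Order.Frame L] : Set L := {a | ∃ φ : RealFun L, RealFun.coz φ = a}

/-- `Coz_c L`: the cozero elements of the functions with countable pointfree image. -/
def CozC (L : Type u) [Order.Frame L] : Set L :=
  {a | ∃ φ : RealFun L, (RealFun.image φ).Countable ∧ RealFun.coz φ = a}

end PointfreeReals

namespace PointfreeReals

open TopologicalSpace

universe u

/-! ### Interpolation for the completely below relation. -/

section Relations

variable {L : Type u} [Order.Frame L]

/-! Everything passes through `ComplementedSeparation`: whenever `a ≺≺ b`, some complemented element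
lies between `a` and `b`.

For condition 1, the complemented elements of `βL` are exactly the principal ideals of complemented
elements of `L`, so zero-dimensionality of `βL` is separation (`stronglyZeroDimensional_iff`). Under
separation a completely regular ideal is generated by its complemented members, which gives `βL ≅
β₀L`; conversely `β₀L` is always zero-dimensional.

From condition 2 to separation: a scale turns `a ≺≺ b` into two covering cozero elements, one below
`b` and the other disjoint from `a`. A function with countable image has many radii at which it can
be cut into complemented pieces, so both cozero elements are countable joins of complemented
elements. Making these joins disjoint (`exists_isCompl_of_iSup_sup_iSup`) yields the separating
element.

From separation to condition 2: a cozero element is the join of the elements `|φ| > 1/(n+1)`, each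
completely below the next. Interpolating complemented elements makes it an increasing countable join
of these, hence the cozero element of a step function with values among `0` and `1/n`
(`iSup_mem_CozC`). -/

theorem RatherBelow.le {a b : L} (h : RatherBelow a b) : a ≤ b := by
  have h' : aᶜ ⊔ b = ⊤ := h
  have : a ⊓ (aᶜ ⊔ b) ≤ b := by
    rw [inf_sup_left, inf_compl_self, bot_sup_eq]
    exact inf_le_right
  rwa [h', inf_top_eq] at this

theorem ratherBelow_of_isComplemented {a b : L} (ha : IsComplemented a) (h : a ≤ b) :
    RatherBelow a b := by
  obtain ⟨c, hc⟩ := ha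
  unfold RatherBelow
  rw [hc.compl_eq]
  exact top_le_iff.1 (hc.sup_eq_top.ge.trans (sup_le (h.trans le_sup_right) le_sup_left))

theorem CompletelyBelow.le {a b : L} (h : CompletelyBelow a b) : a ≤ b := by
  obtain ⟨s, rfl, rfl, hs⟩ := h
  exact (hs 0 1 (Subtype.mk_lt_mk.2 zero_lt_one)).le

theorem completelyBelow_self_of_isComplemented {a : L} (ha : IsComplemented a) :
    CompletelyBelow a a :=
  ⟨fun _ => a, rfl, rfl, fun _ _ _ => ratherBelow_of_isComplemented ha le_rfl⟩

/-- Reparametrize by the affine map of `[0,1]` onto `[p,q]`. -/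
theorem completelyBelow_of_family {s : Set.Icc (0 : ℚ) 1 → L}
    (hs : ∀ p q, p < q → RatherBelow (s p) (s q)) {p q : Set.Icc (0 : ℚ) 1} (hpq : p < q) :
    CompletelyBelow (s p) (s q) := by
  have hpq' : (p : ℚ) < q := hpq
  refine ⟨fun x => s ⟨p + x * (q - p), ?_, ?_⟩, ?_, ?_, fun x y hxy => hs _ _ ?_⟩
  · have := p.2.1
    have := mul_nonneg x.2.1 (sub_nonneg.2 hpq'.le)
    linarith
  · have := q.2.2
    have := mul_le_of_le_one_left (sub_nonneg.2 hpq'.le) x.2.2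
    linarith
  · exact congrArg s (Subtype.ext (by simp))
  · exact congrArg s (Subtype.ext (by simp))
  · have hxy' : (x : ℚ) < y := hxy
    have := mul_lt_mul_of_pos_right hxy' (sub_pos.2 hpq')
    exact Subtype.mk_lt_mk.2 (by linarith)

theorem CompletelyBelow.exists_between {a b : L} (h : CompletelyBelow a b) :
    ∃ c, CompletelyBelow a c ∧ CompletelyBelow c b := by
  obtain ⟨s, rfl, rfl, hs⟩ := h
  have h2 : (1 / 2 : ℚ) ∈ Set.Icc (0 : ℚ) 1 := by norm_num
  exact ⟨s ⟨1 / 2, h2⟩,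
    completelyBelow_of_family hs (Subtype.mk_lt_mk.2 (by norm_num)),
    completelyBelow_of_family hs (Subtype.mk_lt_mk.2 (by norm_num))⟩

/-- Completely below elements are separated by complemented elements. -/
def ComplementedSeparation (L : Type u) [Order.Frame L] : Prop :=
  ∀ a b : L, CompletelyBelow a b → ∃ c, IsComplemented c ∧ a ≤ c ∧ c ≤ b

end Relations

/-! ### Complemented elements of `βL`. -/

section StoneCech

variable {L : Type u} [Order.Frame L]

theorem StoneCech.inf_val (I J : StoneCech L) : (I ⊓ J).1 = I.1 ⊓ J.1 := rfl

theorem StoneCech.sSup_val (S : Set (StoneCech L)) : (sSup S).1 = sSup (Subtype.val '' S) := rfl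

theorem StoneCech.top_val : (⊤ : StoneCech L).1 = ⊤ := rfl

theorem StoneCech.sup_val (I J : StoneCech L) : (I ⊔ J).1 = I.1 ⊔ J.1 := by
  rw [← sSup_pair, StoneCech.sSup_val]
  exact (congrArg SupSet.sSup (Set.image_pair (α := StoneCech L) Subtype.val I J)).trans sSup_pair

theorem StoneCech.bot_val : (⊥ : StoneCech L).1 = ⊥ := by
  rw [← sSup_empty, StoneCech.sSup_val]
  exact (congrArg SupSet.sSup (Set.image_empty (α := StoneCech L) Subtype.val)).trans sSup_empty

/-- The principal ideal of a complemented element, as an element of `βL`. -/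
def StoneCech.principal (c : L) (hc : IsComplemented c) : StoneCech L :=
  ⟨Order.Ideal.principal c, fun _ ha =>
    ⟨c, le_rfl, (completelyBelow_self_of_isComplemented hc).mono ha le_rfl⟩⟩

/-- The elements completely below `b`, as an element of `βL`. -/
def StoneCech.below (b : L) : StoneCech L :=
  ⟨{ carrier := {x | CompletelyBelow x b}
     lower' := fun _ _ hyx hx => hx.mono hyx le_rfl
     nonempty' := ⟨⊥, completelyBelow_bot.mono le_rfl bot_le⟩
     directed' := fun x hx y hy =>
      ⟨x ⊔ y, (CompletelyBelow.sup hx hy).mono le_rfl (sup_idem b).le, le_sup_left,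
        le_sup_right⟩ },
    fun _ ha => (CompletelyBelow.exists_between ha).imp fun _ h => ⟨h.2, h.1⟩⟩

theorem isCompl_principal {A : Type u} [DistribLattice A] [BoundedOrder A] {c d : A}
    (h : IsCompl c d) : IsCompl (Order.Ideal.principal c) (Order.Ideal.principal d) := by
  refine IsCompl.of_eq ?_ ?_
  · refine eq_bot_iff.2 fun x hx => ?_
    have : x ≤ c ⊓ d := le_inf hx.1 hx.2
    rw [h.inf_eq_bot, le_bot_iff] at this
    rw [this]
    exact Order.Ideal.bot_mem _
  · refine Order.Ideal.top_of_top_mem ?_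
    rw [← h.sup_eq_top]
    exact Order.Ideal.sup_mem
      ((le_sup_left : _ ≤ Order.Ideal.principal c ⊔ Order.Ideal.principal d) (le_refl c))
      ((le_sup_right : _ ≤ Order.Ideal.principal c ⊔ Order.Ideal.principal d) (le_refl d))

theorem StoneCech.isComplemented_principal {c : L} (hc : IsComplemented c) :
    IsComplemented (StoneCech.principal c hc) := by
  obtain ⟨d, hd⟩ := hc
  have h := isCompl_principal hd
  refine ⟨StoneCech.principal d ⟨c, hd.symm⟩, IsCompl.of_eq ?_ ?_⟩
  · apply Subtype.ext
    rw [StoneCech.inf_val, StoneCech.bot_val]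
    exact h.inf_eq_bot
  · apply Subtype.ext
    rw [StoneCech.sup_val, StoneCech.top_val]
    exact h.sup_eq_top

/-- If `K` is the complement of `J`, then `⊤ = j ⊔ k` with `j ∈ J` and `k ∈ K`. Members of `J` and
`K` are disjoint, so `j` and `k` are complements and `j` generates `J`. -/
theorem StoneCech.exists_isComplemented_mem {J : StoneCech L} (hJ : IsComplemented J) :
    ∃ c ∈ J.1, IsComplemented c ∧ ∀ a ∈ J.1, a ≤ c := by
  obtain ⟨K, hK⟩ := hJ
  have htop : (⊤ : L) ∈ J.1 ⊔ K.1 := by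
    rw [← StoneCech.sup_val, hK.sup_eq_top]
    trivial
  have hbot : ∀ x ∈ J.1, ∀ y ∈ K.1, x ⊓ y = ⊥ := by
    intro x hx y hy
    have h : x ⊓ y ∈ (J ⊓ K).1 := ⟨J.1.lower inf_le_left hx, K.1.lower inf_le_right hy⟩
    rw [hK.inf_eq_bot, StoneCech.bot_val] at h
    exact le_bot_iff.1 h
  obtain ⟨j, hj, k, hk, hjk⟩ := Order.Ideal.mem_sup.1 htop
  refine ⟨j, hj, ⟨k, IsCompl.of_eq (hbot j hj k hk) (top_le_iff.1 hjk)⟩, fun a ha => ?_⟩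
  have h : a ≤ a ⊓ (j ⊔ k) := le_inf le_rfl (le_top.trans hjk)
  rw [inf_sup_left, hbot a ha k hk, sup_bot_eq] at h
  exact h.trans inf_le_right

/-- The union of a directed family of ideals is already an ideal. -/
theorem StoneCech.mem_of_mem_sSup {S : Set (StoneCech L)} (hb : ⊥ ∈ S)
    (hS : ∀ I ∈ S, ∀ J ∈ S, I ⊔ J ∈ S) {a : L} (ha : a ∈ (sSup S).1) : ∃ I ∈ S, a ∈ I.1 := by
  let T : Order.Ideal L :=
    { carrier := {x | ∃ I ∈ S, x ∈ I.1}
      lower' := fun x y hyx ⟨I, hI, hx⟩ => ⟨I, hI, I.1.lower hyx hx⟩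
      nonempty' := ⟨⊥, ⊥, hb, Order.Ideal.bot_mem _⟩
      directed' := fun x ⟨I, hI, hx⟩ y ⟨J, hJ, hy⟩ =>
        ⟨x ⊔ y, ⟨I ⊔ J, hS I hI J hJ, Order.Ideal.sup_mem
          ((le_sup_left : I ≤ I ⊔ J) hx) ((le_sup_right : J ≤ I ⊔ J) hy)⟩,
          le_sup_left, le_sup_right⟩ }
  have hT : SupSet.sSup (Subtype.val '' S) ≤ T := by
    refine sSup_le ?_
    rintro _ ⟨I, hI, rfl⟩ x hx
    exact ⟨I, hI, hx⟩
  exact hT ha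

/-- Forward, decompose the ideal `StoneCech.below b`: its complemented parts are directed, so one of
them contains `a`, and its generator separates. Backward, the separating elements give principal
ideals that exhaust `I`. -/
theorem stronglyZeroDimensional_iff :
    StronglyZeroDimensional L ↔ ComplementedSeparation L := by
  constructor
  · intro h a b hab
    have ha : a ∈ (StoneCech.below b).1 := hab
    rw [h (StoneCech.below b)] at ha
    obtain ⟨J, ⟨hJ, hJb⟩, haJ⟩ := StoneCech.mem_of_mem_sSup
      (S := {x | IsComplemented x ∧ x ≤ StoneCech.below b})
      ⟨isComplemented_bot, bot_le⟩ (fun I hI J hJ => ⟨hI.1.sup hJ.1, sup_le hI.2 hJ.2⟩) ha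
    obtain ⟨c, hcJ, hc, hJc⟩ := StoneCech.exists_isComplemented_mem hJ
    have hcb : CompletelyBelow c b := hJb hcJ
    exact ⟨c, hc, hJc a haJ, hcb.le⟩
  · intro h I
    refine le_antisymm ?_ (sSup_le fun J hJ => hJ.2)
    intro a ha
    obtain ⟨b, hb, hab⟩ := I.2 a ha
    obtain ⟨c, hc, hac, hcb⟩ := h a b hab
    refine (le_sSup (a := StoneCech.principal c hc) ⟨StoneCech.isComplemented_principal hc, ?_⟩ :
      _ ≤ sSup {J | IsComplemented J ∧ J ≤ I}) (show a ∈ Order.Ideal.principal c from hac)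
    exact fun x hx => I.1.lower (le_trans hx hcb) hb

end StoneCech

/-! ### Zero-dimensionality of `β₀L` and its comparison with `βL`. -/

section Banaschewski

variable {L : Type u} [Order.Frame L]

theorem zeroDimensional_ideal {A : Type u} [DistribLattice A] [BoundedOrder A]
    [ComplementedLattice A] : ZeroDimensional (Order.Ideal A) := by
  intro I
  refine le_antisymm (fun c hc => ?_) (sSup_le fun J hJ => hJ.2)
  obtain ⟨d, hd⟩ := exists_isCompl c
  exact (le_sSup (a := Order.Ideal.principal c) ⟨⟨_, isCompl_principal hd⟩,
    Order.Ideal.principal_le_iff.2 hc⟩ : _ ≤ sSup {J | IsComplemented J ∧ J ≤ I}) (le_refl c)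

theorem Banaschewski.zeroDimensional : ZeroDimensional (Banaschewski L) :=
  zeroDimensional_ideal

theorem ZeroDimensional.of_orderIso {M N : Type u} [Order.Frame M] [Order.Frame N]
    (h : ZeroDimensional N) (e : M ≃o N) : ZeroDimensional M := by
  intro a
  refine le_antisymm ?_ (sSup_le fun x hx => hx.2)
  rw [← e.le_iff_le, h (e a)]
  refine sSup_le ?_
  rintro x ⟨hx, hxa⟩
  rw [← e.apply_symm_apply x, e.le_iff_le]
  obtain ⟨y, hy⟩ := hx
  exact le_sSup ⟨⟨_, e.symm.isCompl hy⟩, e.symm_apply_le.2 hxa⟩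

/-- The complemented elements of an element of `βL`. -/
def StoneCech.toBanaschewski (I : StoneCech L) : Banaschewski L where
  carrier := {c | (c : L) ∈ I.1}
  lower' _ _ hyx hx := I.1.lower hyx hx
  nonempty' := ⟨⊥, by simp⟩
  directed' x hx y hy := ⟨x ⊔ y, Order.Ideal.sup_mem hx hy, le_sup_left, le_sup_right⟩

/-- The ideal of `L` generated by an ideal of complemented elements. -/
def Banaschewski.toStoneCech (J : Banaschewski L) : StoneCech L :=
  ⟨{ carrier := {x | ∃ c ∈ J, x ≤ (c : L)}
     lower' := fun _ _ hyx ⟨c, hc, hx⟩ => ⟨c, hc, le_trans hyx hx⟩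
     nonempty' := ⟨⊥, ⊥, J.bot_mem, bot_le⟩
     directed' := fun x ⟨c, hc, hx⟩ y ⟨d, hd, hy⟩ =>
      ⟨x ⊔ y, ⟨c ⊔ d, Order.Ideal.sup_mem hc hd, sup_le_sup hx hy⟩, le_sup_left,
        le_sup_right⟩ },
    fun _ ⟨c, hc, hx⟩ => ⟨c, ⟨c, hc, le_rfl⟩,
      (completelyBelow_self_of_isComplemented c.2).mono hx le_rfl⟩⟩

/-- Under separation by complemented elements, `βL` and `β₀L` are isomorphic. -/
def ComplementedSeparation.orderIso (h : ComplementedSeparation L) :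
    StoneCech L ≃o Banaschewski L where
  toFun := StoneCech.toBanaschewski
  invFun := Banaschewski.toStoneCech
  left_inv I := by
    refine le_antisymm ?_ ?_
    · rintro x ⟨c, hc, hx⟩
      exact I.1.lower hx hc
    · intro x hx
      obtain ⟨y, hy, hxy⟩ := I.2 x hx
      obtain ⟨c, hc, hxc, hcy⟩ := h x y hxy
      exact ⟨⟨c, hc⟩, I.1.lower hcy hy, hxc⟩
  right_inv J := by
    refine le_antisymm ?_ fun c hc => ⟨c, hc, le_rfl⟩
    rintro c ⟨d, hd, hcd⟩
    exact J.lower hcd hd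
  map_rel_iff' {I J} := by
    refine ⟨fun hIJ x hx => ?_, fun hIJ c hc => hIJ hc⟩
    obtain ⟨y, hy, hxy⟩ := I.2 x hx
    obtain ⟨c, hc, hxc, hcy⟩ := h x y hxy
    have : (⟨c, hc⟩ : Complementeds L) ∈ StoneCech.toBanaschewski J := hIJ (I.1.lower hcy hy)
    exact J.1.lower hxc this

end Banaschewski

/-! ### Real-valued functions from scales. -/

section Scale

variable {L : Type u} [Order.Frame L]

/-- A scale: a family of elements of `L` indexed by the rationals, each member rather below all later
ones, which covers `L` and whose pseudocomplements cover `L`. -/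
structure IsScale (a : ℚ → L) : Prop where
  ratherBelow : ∀ p q, p < q → RatherBelow (a p) (a q)
  iSup_eq : ⨆ q, a q = ⊤
  iSup_compl_eq : ⨆ q, (a q)ᶜ = ⊤

/-- The join of the members of a family below `r`. -/
def lowerPart (a : ℚ → L) (r : ℝ) : L := ⨆ (q : ℚ) (_ : (q : ℝ) < r), a q

/-- The join of the pseudocomplements of the members of a family above `r`. -/
def upperPart (a : ℚ → L) (r : ℝ) : L := ⨆ (q : ℚ) (_ : r < (q : ℝ)), (a q)ᶜ

theorem le_lowerPart (a : ℚ → L) {q : ℚ} {r : ℝ} (h : (q : ℝ) < r) : a q ≤ lowerPart a r :=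
  le_iSup₂_of_le q h le_rfl

theorem le_upperPart (a : ℚ → L) {q : ℚ} {r : ℝ} (h : r < (q : ℝ)) : (a q)ᶜ ≤ upperPart a r :=
  le_iSup₂_of_le q h le_rfl

theorem lowerPart_mono (a : ℚ → L) : Monotone (lowerPart a) := fun _ _ h =>
  iSup₂_le fun _ hq => le_lowerPart a (hq.trans_le h)

theorem upperPart_anti (a : ℚ → L) : Antitone (upperPart a) := fun _ _ h =>
  iSup₂_le fun _ hq => le_upperPart a (h.trans_lt hq)

theorem lowerPart_le_iSup (a : ℚ → L) (r : ℝ) : lowerPart a r ≤ ⨆ s < r, lowerPart a s := by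
  refine iSup₂_le fun q hq => ?_
  obtain ⟨s, hqs, hsr⟩ := exists_between hq
  exact le_iSup₂_of_le s hsr (le_lowerPart a hqs)

theorem upperPart_le_iSup (a : ℚ → L) (r : ℝ) : upperPart a r ≤ ⨆ s > r, upperPart a s := by
  refine iSup₂_le fun q hq => ?_
  obtain ⟨s, hrs, hsq⟩ := exists_between hq
  exact le_iSup₂_of_le s hrs (le_upperPart a hsq)

theorem lowerPart_inf_lowerPart (a : ℚ → L) (r s : ℝ) :
    lowerPart a r ⊓ lowerPart a s = lowerPart a (min r s) :=
  by rcases le_total r s with h | h <;> simp [h, lowerPart_mono a h]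

theorem upperPart_inf_upperPart (a : ℚ → L) (r s : ℝ) :
    upperPart a r ⊓ upperPart a s = upperPart a (max r s) :=
  by rcases le_total r s with h | h <;> simp [h, upperPart_anti a h]

/-- The value on `U` of the real-valued function given by a scale. -/
def scaleFun (a : ℚ → L) (U : Opens ℝ) : L :=
  ⨆ (r : ℝ) (s : ℝ) (_ : Set.Ioo r s ⊆ U), upperPart a r ⊓ lowerPart a s

theorem le_scaleFun (a : ℚ → L) {r s : ℝ} {U : Opens ℝ} (h : Set.Ioo r s ⊆ U) :
    upperPart a r ⊓ lowerPart a s ≤ scaleFun a U :=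
  le_iSup_of_le r (le_iSup₂_of_le s h le_rfl)

theorem scaleFun_mono (a : ℚ → L) : Monotone (scaleFun a) := fun _ _ h =>
  iSup_le fun _ => iSup₂_le fun _ hrs => le_scaleFun a (hrs.trans h)

theorem scaleFun_inf (a : ℚ → L) (U V : Opens ℝ) :
    scaleFun a (U ⊓ V) = scaleFun a U ⊓ scaleFun a V := by
  refine le_antisymm (le_inf (scaleFun_mono a inf_le_left) (scaleFun_mono a inf_le_right)) ?_
  conv_lhs => unfold scaleFun
  simp only [iSup_inf_eq, inf_iSup_eq]
  refine iSup_le fun r => iSup₂_le fun s h => iSup_le fun r' => iSup₂_le fun s' h' => ?_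
  rw [inf_inf_inf_comm, upperPart_inf_upperPart, lowerPart_inf_lowerPart]
  refine le_scaleFun a fun x hx => ?_
  have h1 := max_lt_iff.1 hx.1
  have h2 := lt_min_iff.1 hx.2
  exact ⟨h' ⟨h1.1, h2.1⟩, h ⟨h1.2, h2.2⟩⟩

namespace IsScale

variable {a : ℚ → L}

theorem mono (ha : IsScale a) : Monotone a := fun p q h => by
  rcases h.eq_or_lt with rfl | h
  · exact le_rfl
  · exact (ha.ratherBelow p q h).le

theorem lowerPart_inf_upperPart (ha : IsScale a) (r : ℝ) :
    lowerPart a r ⊓ upperPart a r = ⊥ := by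
  refine eq_bot_iff.2 ?_
  unfold lowerPart upperPart
  simp only [iSup_inf_eq, inf_iSup_eq]
  refine iSup₂_le fun p hp => iSup₂_le fun q hq => ?_
  have h : ∀ x y : ℚ, (x : ℝ) < r → r < y → a x ⊓ (a y)ᶜ ≤ ⊥ := fun x y hx hy =>
    (inf_le_inf_right _ (ha.mono (by exact_mod_cast (hx.trans hy).le))).trans
      (inf_compl_self _).le
  exact h _ _ hq hp

theorem upperPart_sup_lowerPart (ha : IsScale a) {r s : ℝ} (h : r < s) :
    upperPart a r ⊔ lowerPart a s = ⊤ := by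
  obtain ⟨p, hrp, hps⟩ := exists_rat_btwn h
  obtain ⟨q, hpq, hqs⟩ := exists_rat_btwn hps
  have hpq' : p < q := by exact_mod_cast hpq
  exact top_le_iff.1 ((ha.ratherBelow p q hpq').ge.trans
    (sup_le_sup (le_upperPart a hrp) (le_lowerPart a hqs)))

theorem iSup_lowerPart (ha : IsScale a) : ⨆ r, lowerPart a r = ⊤ := by
  refine top_le_iff.1 (ha.iSup_eq.ge.trans (iSup_le fun q => ?_))
  exact le_iSup_of_le ((q : ℝ) + 1) (le_lowerPart a (lt_add_one _))

theorem iSup_upperPart (ha : IsScale a) : ⨆ r, upperPart a r = ⊤ := by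
  refine top_le_iff.1 (ha.iSup_compl_eq.ge.trans (iSup_le fun q => ?_))
  exact le_iSup_of_le ((q : ℝ) - 1) (le_upperPart a (sub_one_lt _))

theorem scaleFun_top (ha : IsScale a) : scaleFun a ⊤ = ⊤ := by
  refine top_le_iff.1 ?_
  rw [← inf_top_eq (⊤ : L)]
  nth_rewrite 1 [← ha.iSup_upperPart]
  rw [← ha.iSup_lowerPart]
  simp only [iSup_inf_eq, inf_iSup_eq]
  refine iSup_le fun r => iSup_le fun s => ?_
  exact le_scaleFun a (Set.subset_univ _)

/-- A pointfree Heine–Borel argument: the bound by `R` holds locally, and the supremum of the right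
endpoints up to which it holds must be `s`. -/
theorem scaleFun_sSup_le (ha : IsScale a) (S : Set (Opens ℝ)) :
    scaleFun a (sSup S) ≤ sSup (scaleFun a '' S) := by
  refine iSup_le fun r₀ => iSup₂_le fun s h => ?_
  -- Shrinking the left endpoint to some `r > r₀` keeps `sSup T` inside the open interval whenever
  -- it is less than `s`.
  refine (inf_le_inf_right _ (upperPart_le_iSup a r₀)).trans ?_
  rw [iSup₂_inf_eq]
  refine iSup₂_le fun r hr => ?_
  set R := sSup (scaleFun a '' S) with hR
  have hloc : ∀ x ∈ Set.Ioo r₀ s, ∃ ε > 0, upperPart a (x - ε) ⊓ lowerPart a (x + ε) ≤ R := by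
    intro x hx
    obtain ⟨U, hU, hxU⟩ := Opens.mem_sSup.1 (h hx)
    obtain ⟨ε, hε, hb⟩ := Metric.isOpen_iff.1 U.isOpen x hxU
    rw [Real.ball_eq_Ioo] at hb
    exact ⟨ε, hε, (le_scaleFun a hb).trans (le_sSup (Set.mem_image_of_mem _ hU))⟩
  set T : Set ℝ := {t | t ≤ s ∧ upperPart a r ⊓ lowerPart a t ≤ R} with hT
  by_cases hrs : s ≤ r
  · rw [inf_comm]
    exact ((inf_le_inf_right _ (lowerPart_mono a hrs)).trans
      (ha.lowerPart_inf_upperPart r).le).trans bot_le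
  push Not at hrs
  have hrT : r ∈ T := ⟨hrs.le, by
    rw [inf_comm]; exact (ha.lowerPart_inf_upperPart r).le.trans bot_le⟩
  have hbdd : BddAbove T := ⟨s, fun t ht => ht.1⟩
  have hrt : r ≤ sSup T := le_csSup hbdd hrT
  have hts : sSup T ≤ s := csSup_le ⟨r, hrT⟩ fun t ht => ht.1
  -- The supremum belongs to `T` because `lowerPart` is left-continuous.
  have htT : upperPart a r ⊓ lowerPart a (sSup T) ≤ R := by
    refine (inf_le_inf_left _ (lowerPart_le_iSup a _)).trans ?_
    rw [inf_iSup₂_eq]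
    refine iSup₂_le fun t ht => ?_
    obtain ⟨t', ht', htt'⟩ := exists_lt_of_lt_csSup ⟨r, hrT⟩ ht
    exact (inf_le_inf_left _ (lowerPart_mono a htt'.le)).trans ht'.2
  rcases hts.eq_or_lt with heq | hlt
  · rwa [heq] at htT
  exfalso
  obtain ⟨ε, hε, hle⟩ := hloc (sSup T) ⟨lt_of_lt_of_le hr hrt, hlt⟩
  -- Splitting along this cover extends the bound beyond `sSup T`: `hle` bounds one piece, `htT` the
  -- other.
  have hcov : ⊤ ≤ upperPart a (sSup T - ε) ⊔ lowerPart a (sSup T) :=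
    (ha.upperPart_sup_lowerPart (by linarith)).ge
  have hmem : min s (sSup T + ε) ∈ T := by
    refine ⟨min_le_left _ _, ?_⟩
    refine (inf_le_inf_left _ (lowerPart_mono a (min_le_right _ _))).trans ?_
    refine (le_inf (le_top.trans hcov) le_rfl).trans ?_
    rw [inf_sup_right]
    refine sup_le ?_ ?_
    · exact (inf_le_inf_left _ inf_le_right).trans hle
    · rw [inf_comm]
      exact (inf_le_inf_right _ inf_le_left).trans htT
  have := le_csSup hbdd hmem
  rcases min_le_iff.1 this with h1 | h1 <;> linarith

/-- The continuous real-valued function given by a scale. -/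
def realFun (ha : IsScale a) : RealFun L where
  toFun := scaleFun a
  map_inf' := scaleFun_inf a
  map_top' := ha.scaleFun_top
  map_sSup' S := by
    refine le_antisymm (ha.scaleFun_sSup_le S) (sSup_le ?_)
    rintro _ ⟨U, hU, rfl⟩
    exact scaleFun_mono a (le_sSup hU)

/-- A nonempty interval `(p, q)` inside the ray forces `q ≤ r`; an empty one contributes `⊥`. -/
theorem realFun_Iio (ha : IsScale a) (r : ℝ) :
    ha.realFun ⟨Set.Iio r, isOpen_Iio⟩ = lowerPart a r := by
  refine le_antisymm (iSup_le fun p => iSup₂_le fun q h => ?_) ?_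
  · by_cases hpq : p < q
    · refine inf_le_right.trans (lowerPart_mono a (le_of_forall_lt fun x hx => ?_))
      obtain ⟨y, hy, hyq⟩ := exists_between (max_lt hx hpq)
      exact (max_lt_iff.1 hy).1.trans (h ⟨(max_lt_iff.1 hy).2, hyq⟩)
    · rw [inf_comm]
      exact ((inf_le_inf_right _ (lowerPart_mono a (not_lt.1 hpq))).trans
        (ha.lowerPart_inf_upperPart p).le).trans bot_le
  · rw [← inf_top_eq (lowerPart a r), ← ha.iSup_upperPart, inf_iSup_eq]
    refine iSup_le fun p => ?_
    rw [inf_comm]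
    exact le_scaleFun a fun x hx => hx.2

theorem realFun_Ioi (ha : IsScale a) (r : ℝ) :
    ha.realFun ⟨Set.Ioi r, isOpen_Ioi⟩ = upperPart a r := by
  refine le_antisymm (iSup_le fun p => iSup₂_le fun q h => ?_) ?_
  · by_cases hpq : p < q
    · refine inf_le_left.trans (upperPart_anti a (le_of_forall_gt fun x hx => ?_))
      obtain ⟨y, hpy, hy⟩ := exists_between (lt_min hx hpq)
      exact (h ⟨hpy, (lt_min_iff.1 hy).2⟩ : r < y).trans (lt_min_iff.1 hy).1
    · rw [inf_comm]
      exact ((inf_le_inf_right _ (lowerPart_mono a (not_lt.1 hpq))).trans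
        (ha.lowerPart_inf_upperPart p).le).trans bot_le
  · rw [← inf_top_eq (upperPart a r), ← ha.iSup_lowerPart, inf_iSup_eq]
    exact iSup_le fun p => le_scaleFun a fun x hx => hx.1

end IsScale

end Scale

/-! ### Cozero elements and pointfree images. -/

namespace RealFun

variable {L : Type u} [Order.Frame L]

theorem map_Iio_sup_map_Ioi (φ : RealFun L) (r : ℝ) :
    φ ⟨Set.Iio r, isOpen_Iio⟩ ⊔ φ ⟨Set.Ioi r, isOpen_Ioi⟩ =
      φ ⟨{r}ᶜ, isOpen_compl_singleton⟩ := by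
  rw [← map_sup]
  congr 1
  ext x
  simp

theorem coz_eq (φ : RealFun L) : coz φ = φ ⟨{0}ᶜ, isOpen_compl_singleton⟩ :=
  map_Iio_sup_map_Ioi φ 0

theorem const_apply_of_mem {r : ℝ} {U : Opens ℝ} (h : r ∈ U) : const L r U = ⊤ :=
  iSup_pos h

theorem const_apply_of_notMem {r : ℝ} {U : Opens ℝ} (h : r ∉ U) : const L r U = ⊥ :=
  iSup_neg h

/-- Subtracting a constant is translation. For `≥`, continuity of subtraction at `(x, r)` gives a
box `A × B`, on which the constant contributes `⊤`. -/
theorem sub_const_apply (φ : RealFun L) (r : ℝ) (U : Opens ℝ) :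
    sub φ (const L r) U = φ (Opens.comap ⟨fun x => x - r, by fun_prop⟩ U) := by
  change subFun φ (const L r) U = _
  refine le_antisymm (iSup_le fun V => iSup₂_le fun W h => ?_) ?_
  · by_cases hr : r ∈ W
    · exact inf_le_left.trans (OrderHomClass.mono φ fun v hv => h v hv r hr)
    · rw [const_apply_of_notMem hr, inf_bot_eq]
      exact bot_le
  · have hU : Opens.comap ⟨fun x => x - r, by fun_prop⟩ U ≤
        sSup {V : Opens ℝ | φ V ≤ subFun φ (const L r) U} := by
      intro x hx
      have hc : Continuous fun z : ℝ × ℝ => z.1 - z.2 := continuous_fst.sub continuous_snd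
      obtain ⟨A, B, hA, hB, hxA, hrB, hAB⟩ := isOpen_prod_iff.1 (U.isOpen.preimage hc) x r hx
      refine Opens.mem_sSup.2 ⟨⟨A, hA⟩, ?_, hxA⟩
      have := le_subFun φ (const L r) (U := U) (V := ⟨A, hA⟩) (W := ⟨B, hB⟩)
        fun v hv w hw => hAB (Set.mk_mem_prod hv hw)
      rwa [const_apply_of_mem (L := L) (U := ⟨B, hB⟩) hrB, inf_top_eq] at this
    refine (OrderHomClass.mono φ hU).trans ?_
    rw [map_sSup]
    refine sSup_le ?_
    rintro _ ⟨V, hV, rfl⟩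
    exact hV

theorem mem_image_iff (φ : RealFun L) (r : ℝ) :
    r ∈ image φ ↔ φ ⟨{r}ᶜ, isOpen_compl_singleton⟩ ≠ ⊤ := by
  have h : (Opens.comap ⟨fun x => x - r, by fun_prop⟩ ⟨{0}ᶜ, isOpen_compl_singleton⟩ : Opens ℝ) =
      ⟨{r}ᶜ, isOpen_compl_singleton⟩ := by
    ext x
    simp [sub_eq_zero]
  unfold image
  rw [Set.mem_ofPred_eq, coz_eq, sub_const_apply, h]

theorem map_mem_Coz (φ : RealFun L) (g : C(ℝ, ℝ)) :
    φ (Opens.comap g ⟨{0}ᶜ, isOpen_compl_singleton⟩) ∈ Coz L :=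
  ⟨φ.comp (Opens.comap g), coz_eq _⟩

theorem map_Iio_mem_Coz (φ : RealFun L) (r : ℝ) : φ ⟨Set.Iio r, isOpen_Iio⟩ ∈ Coz L := by
  -- This truncation is nonzero exactly on the ray.
  convert map_mem_Coz φ ⟨fun x => max (r - x) 0, by fun_prop⟩
  ext x
  simp

theorem map_Ioi_mem_Coz (φ : RealFun L) (r : ℝ) : φ ⟨Set.Ioi r, isOpen_Ioi⟩ ∈ Coz L := by
  convert map_mem_Coz φ ⟨fun x => max (x - r) 0, by fun_prop⟩
  ext x
  simp

theorem isCompl_of_notMem_image (φ : RealFun L) {r : ℝ} (h : r ∉ image φ) :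
    IsCompl (φ ⟨Set.Iio r, isOpen_Iio⟩) (φ ⟨Set.Ioi r, isOpen_Ioi⟩) := by
  rw [mem_image_iff, not_not] at h
  refine IsCompl.of_eq ?_ ((map_Iio_sup_map_Ioi φ r).trans h)
  rw [← map_inf, ← map_bot φ]
  congr 1
  ext x
  simpa using fun h : x < r => h.le

/-- The open set `W` witnesses the relation, since `φ W` lies below the pseudocomplement of `φ U`.
-/
theorem map_ratherBelow (φ : RealFun L) {U V W : Opens ℝ} (h : W ⊓ U = ⊥) (h' : W ⊔ V = ⊤) :
    RatherBelow (φ U) (φ V) := by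
  have h1 : φ W ≤ (φ U)ᶜ := by
    rw [le_compl_iff_disjoint_right, disjoint_iff, ← map_inf, h, map_bot]
  refine top_le_iff.1 ?_
  rw [← map_top φ, ← h', map_sup]
  exact sup_le_sup_right h1 _

/-- The reals of absolute value greater than `t`. -/
def absGt (t : ℝ) : Opens ℝ := ⟨{x | t < |x|}, isOpen_lt continuous_const continuous_abs⟩

theorem completelyBelow_absGt (φ : RealFun L) {s t : ℝ} (h : s < t) :
    CompletelyBelow (φ (absGt t)) (φ (absGt s)) := by
  -- The radius falls linearly from `t` to `s`, so the open sets grow with `p`.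
  refine ⟨fun p => φ (absGt (t + (p : ℚ) * (s - t))), by simp, by simp, fun p q hpq => ?_⟩
  have hpq' : ((p : ℚ) : ℝ) < (q : ℚ) := by exact_mod_cast hpq
  have hlt := mul_lt_mul_of_neg_right hpq' (sub_neg.2 h)
  refine map_ratherBelow φ
    (W := ⟨{x | |x| < t + (p : ℚ) * (s - t)}, isOpen_lt continuous_abs continuous_const⟩) ?_ ?_
  · ext x
    simpa [absGt] using fun h : |x| < _ => h.le
  · ext x
    simp only [absGt, Opens.coe_sup, Opens.coe_mk, Set.mem_union, Set.mem_ofPred_eq,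
      Opens.coe_top, Set.mem_univ, iff_true]
    by_contra! hx
    linarith [hx.1, hx.2]

theorem coz_eq_iSup_absGt (φ : RealFun L) {r : ℕ → ℝ} (hr : ∀ n, 0 ≤ r n)
    (hr' : ∀ x > 0, ∃ n, r n < x) : coz φ = ⨆ n, φ (absGt (r n)) := by
  rw [coz_eq, ← map_iSup]
  congr 1
  ext x
  simp only [absGt, Opens.coe_mk, Set.mem_compl_iff, Set.mem_singleton_iff, Opens.coe_iSup,
    Set.mem_iUnion, Set.mem_ofPred_eq]
  exact ⟨fun h => hr' _ (abs_pos.2 h), fun ⟨n, hn⟩ => abs_pos.1 ((hr n).trans_lt hn)⟩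

theorem isComplemented_absGt (φ : RealFun L) {t : ℝ} (h : t ∉ image φ)
    (h' : -t ∉ image φ) : IsComplemented (φ (absGt t)) := by
  have : absGt t = ⟨Set.Iio (-t), isOpen_Iio⟩ ⊔ ⟨Set.Ioi t, isOpen_Ioi⟩ := by
    ext x
    simp only [absGt, Opens.coe_mk, Opens.coe_sup, Set.mem_union, Set.mem_ofPred_eq, Set.mem_Iio,
      Set.mem_Ioi, lt_abs, lt_neg]
    exact or_comm
  rw [this, map_sup]
  exact IsComplemented.sup ⟨_, isCompl_of_notMem_image φ h'⟩ ⟨_, (isCompl_of_notMem_image φ h).symm⟩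

/-- The reals `r` with `r` and `-r` both off the image are dense, so radii tending to `0` can be
chosen among them; cutting there gives complemented elements. -/
theorem exists_isComplemented_of_countable (φ : RealFun L) (h : (image φ).Countable) :
    ∃ c : ℕ → L, (∀ n, IsComplemented (c n)) ∧ coz φ = ⨆ n, c n := by
  have hc : (image φ ∪ Neg.neg ⁻¹' image φ).Countable :=
    h.union (h.preimage neg_injective)
  have hex : ∀ n : ℕ, ∃ r, 0 < r ∧ r < 1 / ((n : ℝ) + 1) ∧ r ∉ image φ ∧ -r ∉ image φ := by
    intro n
    obtain ⟨r, hr, hr'⟩ := hc.dense_compl ℝ |>.exists_between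
      (show (0 : ℝ) < 1 / ((n : ℝ) + 1) by positivity)
    exact ⟨r, hr'.1, hr'.2, fun h => hr (Or.inl h), fun h => hr (Or.inr h)⟩
  choose r hr0 hr1 hr2 hr3 using hex
  refine ⟨_, fun n => isComplemented_absGt φ (hr2 n) (hr3 n),
    coz_eq_iSup_absGt φ (fun n => (hr0 n).le) fun x hx => ?_⟩
  obtain ⟨n, hn⟩ := exists_nat_one_div_lt hx
  exact ⟨n, (hr1 n).trans hn⟩

end RealFun

/-! ### Separation and countable joins of complemented elements. -/

section Separation

variable {L : Type u} [Order.Frame L]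

theorem isComplemented_finsetSup {c : ℕ → L} (hc : ∀ n, IsComplemented (c n)) (s : Finset ℕ) :
    IsComplemented (s.sup c) :=
  Finset.sup_induction isComplemented_bot (fun _ ha _ hb => ha.sup hb) fun n _ => hc n

theorem IsComplemented.sup_compl_eq_top {a : L} (ha : IsComplemented a) : a ⊔ aᶜ = ⊤ := by
  obtain ⟨b, hb⟩ := ha
  rw [hb.compl_eq, hb.sup_eq_top]

theorem IsComplemented.compl_compl_eq {a : L} (ha : IsComplemented a) : aᶜᶜ = a := by
  obtain ⟨b, hb⟩ := ha
  rw [hb.compl_eq, hb.symm.compl_eq]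

theorem IsComplemented.compl {a : L} (ha : IsComplemented a) : IsComplemented aᶜ := by
  obtain ⟨b, hb⟩ := ha
  exact ⟨a, hb.compl_eq ▸ hb.symm⟩

theorem exists_isCompl_of_iSup_sup_iSup {c d : ℕ → L} (hc : ∀ n, IsComplemented (c n))
    (hd : ∀ n, IsComplemented (d n)) (h : (⨆ n, c n) ⊔ ⨆ n, d n = ⊤) :
    ∃ w w', IsCompl w w' ∧ w ≤ ⨆ n, c n ∧ w' ≤ ⨆ n, d n := by
  -- Disjointify in the order `c 0, d 0, c 1, d 1, …`. Using `range n` here but `range (n + 1)` for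
  -- `w'` makes `c n` precede `d n`, so of any `c n` and `d m` exactly one is removed from the
  -- other.
  set w := ⨆ n, c n ⊓ ((Finset.range n).sup d)ᶜ with hw
  set w' := ⨆ n, d n ⊓ ((Finset.range (n + 1)).sup c)ᶜ with hw'
  have split : ∀ x y e : L, IsComplemented y → y ≤ e → x ⊓ yᶜ ≤ e → x ≤ e := by
    intro x y e hy h1 h2
    rw [← inf_top_eq x, ← IsComplemented.sup_compl_eq_top hy, inf_sup_left]
    exact sup_le (inf_le_right.trans h1) h2
  have hcd : ∀ n, c n ≤ w ⊔ w' ∧ d n ≤ w ⊔ w' := by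
    intro n
    induction n using Nat.strong_induction_on with
    | _ n ih =>
      have h1 : c n ≤ w ⊔ w' := split _ _ _ (isComplemented_finsetSup hd (Finset.range n))
        (Finset.sup_le fun k hk => (ih k (Finset.mem_range.1 hk)).2)
        ((le_iSup (fun n => c n ⊓ ((Finset.range n).sup d)ᶜ) n).trans le_sup_left)
      refine ⟨h1, split _ _ _ (isComplemented_finsetSup hc (Finset.range (n + 1)))
        (Finset.sup_le fun k hk => ?_)
        ((le_iSup (fun n => d n ⊓ ((Finset.range (n + 1)).sup c)ᶜ) n).trans le_sup_right)⟩
      rcases (Nat.lt_succ_iff.1 (Finset.mem_range.1 hk)).eq_or_lt with rfl | hk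
      · exact h1
      · exact (ih k hk).1
  refine ⟨w, w', IsCompl.of_eq ?_ ?_, iSup_mono fun n => inf_le_left, iSup_mono fun n =>
    inf_le_left⟩
  · rw [eq_bot_iff, hw, hw', iSup_inf_iSup]
    refine iSup_le fun ⟨n, m⟩ => ?_
    rcases lt_or_ge m n with hmn | hmn
    · rw [← inf_compl_self ((Finset.range n).sup d), inf_comm]
      exact inf_le_inf (inf_le_left.trans (Finset.le_sup (f := d) (Finset.mem_range.2 hmn)))
        inf_le_right
    · rw [← inf_compl_self ((Finset.range (m + 1)).sup c)]
      exact inf_le_inf (inf_le_left.trans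
        (Finset.le_sup (f := c) (Finset.mem_range.2 (Nat.lt_succ_of_le hmn)))) inf_le_right
  · exact top_le_iff.1 (h.ge.trans
      (sup_le (iSup_le fun n => (hcd n).1) (iSup_le fun n => (hcd n).2)))

/-- The extension to the rationals, by `⊥` and `⊤`, of a family indexed by the unit interval. -/
def extendFamily (s : Set.Icc (0 : ℚ) 1 → L) (q : ℚ) : L :=
  if h0 : q < 0 then ⊥ else if h1 : 1 < q then ⊤ else s ⟨q, not_lt.1 h0, not_lt.1 h1⟩

theorem isScale_extendFamily {s : Set.Icc (0 : ℚ) 1 → L}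
    (hs : ∀ p q, p < q → RatherBelow (s p) (s q)) : IsScale (extendFamily s) where
  ratherBelow p q hpq := by
    unfold extendFamily
    by_cases hp : p < 0
    · simp [hp, RatherBelow]
    by_cases hq : 1 < q
    · have : ¬ q < 0 := by linarith
      simp [hq, this, RatherBelow]
    · have h1 : ¬ q < 0 := by linarith
      have h2 : ¬ 1 < p := by linarith
      simp only [hp, hq, h1, h2, dite_false]
      exact hs _ _ hpq
  iSup_eq := top_le_iff.1 (le_iSup_of_le 2 (by norm_num [extendFamily]))
  iSup_compl_eq := top_le_iff.1 (le_iSup_of_le (-1) (by norm_num [extendFamily]))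

/-- The witnessing family, extended to all rationals, is a scale; its function separates `a` from
`b` at the levels `0` and `1`. -/
theorem CompletelyBelow.exists_realFun {a b : L} (h : CompletelyBelow a b) :
    ∃ φ : RealFun L, ∃ r s : ℝ, r < s ∧ φ ⟨Set.Iio s, isOpen_Iio⟩ ≤ b ∧
      φ ⟨Set.Ioi r, isOpen_Ioi⟩ ⊓ a = ⊥ := by
  obtain ⟨t, rfl, rfl, ht⟩ := h
  have hsc := isScale_extendFamily ht
  have h0 : extendFamily t 0 = t 0 := by norm_num [extendFamily]; rfl
  have h1 : extendFamily t 1 = t 1 := by norm_num [extendFamily]; rfl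
  refine ⟨hsc.realFun, 0, 1, zero_lt_one, ?_, ?_⟩
  · rw [hsc.realFun_Iio, ← h1]
    exact iSup₂_le fun q hq => hsc.mono (by exact_mod_cast hq.le)
  · rw [hsc.realFun_Ioi, ← h0, eq_bot_iff, ← compl_inf_self (extendFamily t 0)]
    exact inf_le_inf_right _ (iSup₂_le fun q hq =>
      compl_le_compl (hsc.mono (by exact_mod_cast hq.le)))

theorem complementedSeparation_of_Coz_eq (h : Coz L = CozC L) : ComplementedSeparation L := by
  intro a b hab
  obtain ⟨φ, r, s, hrs, hb, ha⟩ := hab.exists_realFun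
  have hu := RealFun.map_Iio_mem_Coz φ s
  have hv := RealFun.map_Ioi_mem_Coz φ r
  rw [h] at hu hv
  obtain ⟨α, hα, hαu⟩ := hu
  obtain ⟨β, hβ, hβv⟩ := hv
  obtain ⟨c, hc, hcα⟩ := α.exists_isComplemented_of_countable hα
  obtain ⟨d, hd, hdβ⟩ := β.exists_isComplemented_of_countable hβ
  rw [hαu] at hcα
  rw [hβv] at hdβ
  -- The rays below `s` and above `r` cover the line because `r < s`.
  have hcov : (⨆ n, c n) ⊔ ⨆ n, d n = ⊤ := by
    rw [← hcα, ← hdβ, ← map_sup, ← map_top φ]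
    congr 1
    ext x
    simpa using (lt_or_ge x s).imp_right hrs.trans_le
  obtain ⟨w, w', hww, hwc, hwd⟩ := exists_isCompl_of_iSup_sup_iSup hc hd hcov
  refine ⟨w, ⟨w', hww⟩, ?_, hwc.trans (hcα.ge.trans hb)⟩
  rw [← inf_top_eq a, ← hww.sup_eq_top, inf_sup_left]
  refine sup_le inf_le_right ?_
  rw [inf_comm]
  exact (inf_le_inf_right a (hwd.trans hdβ.ge)).trans (ha.le.trans bot_le)

/-- The family `⊥` for `q ≤ 0` and `(e n)*` for `1 / (n + 1) < q ≤ 1 / n`. -/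
def stepFamily (e : ℕ → L) (q : ℚ) : L := if q ≤ 0 then ⊥ else (e ⌊q⁻¹⌋₊)ᶜ

theorem stepFamily_of_pos (e : ℕ → L) {q : ℚ} (hq : 0 < q) : stepFamily e q = (e ⌊q⁻¹⌋₊)ᶜ :=
  if_neg hq.not_ge

theorem stepFamily_of_nonpos (e : ℕ → L) {q : ℚ} (hq : q ≤ 0) : stepFamily e q = ⊥ :=
  if_pos hq

/-! ### Step functions with countable image. -/

section StepFamily

variable {e : ℕ → L}

theorem stepFamily_mono (he : Monotone e) : Monotone (stepFamily e) := by
  intro p q hpq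
  rcases le_or_gt p 0 with hp | hp
  · rw [stepFamily_of_nonpos e hp]
    exact bot_le
  · rw [stepFamily_of_pos e hp, stepFamily_of_pos e (hp.trans_le hpq)]
    exact compl_le_compl (he (Nat.floor_mono (inv_anti₀ hp hpq)))

theorem isComplemented_stepFamily (hc : ∀ n, IsComplemented (e n)) (q : ℚ) :
    IsComplemented (stepFamily e q) := by
  unfold stepFamily
  split_ifs
  · exact isComplemented_bot
  · exact IsComplemented.compl (hc _)

theorem isScale_stepFamily (he : Monotone e) (hc : ∀ n, IsComplemented (e n)) (h0 : e 0 = ⊥) :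
    IsScale (stepFamily e) where
  ratherBelow p q hpq :=
    ratherBelow_of_isComplemented (isComplemented_stepFamily hc p) (stepFamily_mono he hpq.le)
  iSup_eq := by
    -- Beyond `q = 1` the floor of `q⁻¹` is `0`, so `e 0 = ⊥` makes the family reach `⊤`.
    refine top_le_iff.1 (le_iSup_of_le 2 ?_)
    have : ⌊(2 : ℚ)⁻¹⌋₊ = 0 := Nat.floor_eq_zero.2 (by norm_num)
    rw [stepFamily_of_pos e two_pos, this, h0, compl_bot]
  iSup_compl_eq := by
    refine top_le_iff.1 (le_iSup_of_le 0 ?_)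
    rw [stepFamily_of_nonpos e le_rfl, compl_bot]

theorem coz_stepFamily (he : Monotone e) (hc : ∀ n, IsComplemented (e n)) (h0 : e 0 = ⊥) :
    (isScale_stepFamily he hc h0).realFun.coz = ⨆ n, e n := by
  unfold RealFun.coz
  rw [IsScale.realFun_Iio, IsScale.realFun_Ioi]
  refine le_antisymm (sup_le (iSup₂_le fun q hq => ?_) (iSup₂_le fun q hq => ?_))
    (le_trans (iSup_le fun n => ?_) le_sup_right)
  · rw [stepFamily_of_nonpos e (by exact_mod_cast hq.le)]
    exact bot_le
  · rw [stepFamily_of_pos e (by exact_mod_cast hq), IsComplemented.compl_compl_eq (hc _)]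
    exact le_iSup e _
  -- The index `n + 1` avoids inverting `0`; it bounds `e (n + 1)`, which dominates `e n`.
  · have hn : (0 : ℚ) < ((n + 1 : ℕ) : ℚ)⁻¹ := by positivity
    have h := le_upperPart (stepFamily e) (r := 0) (q := ((n + 1 : ℕ) : ℚ)⁻¹)
      (by exact_mod_cast hn)
    rw [stepFamily_of_pos e hn, inv_inv, Nat.floor_natCast,
      IsComplemented.compl_compl_eq (hc _)] at h
    exact (he n.le_succ).trans h

/-- Strictly between consecutive values `1/(n+1)` and `1/n` the scale is constantly `(e n)ᶜ`, so the
lower and upper parts at `r` dominate `(e n)ᶜ` and `e n`, which cover. -/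
theorem image_stepFamily_subset (he : Monotone e) (hc : ∀ n, IsComplemented (e n))
    (h0 : e 0 = ⊥) :
    (isScale_stepFamily he hc h0).realFun.image ⊆ Set.range fun n : ℕ => (n : ℝ)⁻¹ := by
  intro r hr
  by_contra hrn
  rw [RealFun.mem_image_iff, ← RealFun.map_Iio_sup_map_Ioi, IsScale.realFun_Iio,
    IsScale.realFun_Ioi] at hr
  refine hr (top_le_iff.1 ?_)
  rcases lt_trichotomy r 0 with hr0 | rfl | hr0
  · obtain ⟨q, hrq, hq⟩ := exists_rat_btwn hr0
    have h := le_upperPart (stepFamily e) hrq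
    rw [stepFamily_of_nonpos e (by exact_mod_cast hq.le), compl_bot] at h
    exact h.trans le_sup_right
  -- The value `0` is in the range as `0⁻¹ = 0`.
  · exact absurd ⟨0, by simp⟩ hrn
  · set n := ⌊r⁻¹⌋₊ with hn
    have hlt : r⁻¹ < n + 1 := Nat.lt_floor_add_one _
    have hgt : (n : ℝ) < r⁻¹ := (Nat.floor_le (by positivity)).lt_of_ne fun h =>
      hrn ⟨n, inv_eq_iff_eq_inv.2 h⟩
    have hl : ((n : ℝ) + 1)⁻¹ < r := inv_lt_of_inv_lt₀ hr0 hlt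
    obtain ⟨q, hq, hqr⟩ := exists_rat_btwn hl
    obtain ⟨p, hrp, hp⟩ : ∃ p : ℚ, r < p ∧ (n : ℝ) < (p : ℝ)⁻¹ := by
      -- For `n = 0` there is no upper limit `1/n`, and any rational `p > r` serves.
      rcases Nat.eq_zero_or_pos n with h | h
      · obtain ⟨p, hp⟩ := exists_rat_gt r
        refine ⟨p, hp, ?_⟩
        rw [h, Nat.cast_zero]
        exact inv_pos.2 (hr0.trans hp)
      · have hn' : (0 : ℝ) < n := by exact_mod_cast h
        obtain ⟨p, hrp, hp⟩ := exists_rat_btwn ((lt_inv_comm₀ hn' hr0).1 hgt)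
        exact ⟨p, hrp, (lt_inv_comm₀ (hr0.trans hrp) hn').1 hp⟩
    have hq0 : (0 : ℝ) < q := lt_trans (by positivity) hq
    have hq1 : (q : ℝ)⁻¹ < n + 1 := inv_lt_of_inv_lt₀ (by positivity) hq
    have hp0 : (0 : ℝ) < p := hr0.trans hrp
    have hpq : (p : ℝ)⁻¹ < (q : ℝ)⁻¹ := inv_strictAnti₀ hq0 (hqr.trans hrp)
    have key : ∀ x : ℚ, (0 : ℝ) < x → (n : ℝ) < (x : ℝ)⁻¹ → (x : ℝ)⁻¹ < n + 1 →
        stepFamily e x = (e n)ᶜ := by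
      intro x hx h1 h2
      have : ⌊x⁻¹⌋₊ = n := by
        refine (Nat.floor_eq_iff ?_).2 ⟨?_, ?_⟩
        · exact inv_nonneg.2 (by exact_mod_cast hx.le)
        · exact_mod_cast h1.le
        · exact_mod_cast h2
      rw [stepFamily_of_pos e (by exact_mod_cast hx), this]
    have hu := le_upperPart (stepFamily e) hrp
    have hl := le_lowerPart (stepFamily e) hqr
    rw [key p hp0 hp (hpq.trans hq1), IsComplemented.compl_compl_eq (hc n)] at hu
    rw [key q hq0 (hp.trans hpq) hq1] at hl
    rw [← IsComplemented.sup_compl_eq_top (hc n), sup_comm]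
    exact sup_le_sup hl hu

theorem iSup_mem_CozC (he : Monotone e) (hc : ∀ n, IsComplemented (e n)) : ⨆ n, e n ∈ CozC L := by
  -- Prepending `⊥` supplies the initial value needed for a scale without changing the join.
  let e' : ℕ → L := fun n => Nat.casesOn n ⊥ e
  have he' : Monotone e' := monotone_nat_of_le_succ fun n => by
    cases n with
    | zero => exact bot_le
    | succ n => exact he n.le_succ
  have hc' : ∀ n, IsComplemented (e' n) := fun n => by
    cases n with
    | zero => exact isComplemented_bot
    | succ n => exact hc n
  refine ⟨(isScale_stepFamily he' hc' rfl).realFun,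
    (Set.countable_range _).mono (image_stepFamily_subset he' hc' rfl), ?_⟩
  rw [coz_stepFamily he' hc' rfl, ← sup_iSup_nat_succ]
  exact bot_sup_eq _

end StepFamily

theorem ComplementedSeparation.Coz_eq (h : ComplementedSeparation L) : Coz L = CozC L := by
  refine Set.Subset.antisymm ?_ fun _ ⟨φ, _, hφ⟩ => ⟨φ, hφ⟩
  rintro _ ⟨φ, rfl⟩
  let r : ℕ → ℝ := fun n => 1 / ((n : ℝ) + 1)
  have hr : ∀ n, r (n + 1) < r n := fun n =>
    one_div_lt_one_div_of_lt (by positivity) (by push_cast; linarith)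
  -- Each `d n` lies between `|φ| > r n` and `|φ| > r (n + 1)`, so the sequence increases and has
  -- the same join.
  choose d hd hd1 hd2 using fun n => h _ _ (φ.completelyBelow_absGt (hr n))
  have hmono : Monotone d := monotone_nat_of_le_succ fun n => (hd2 n).trans (hd1 (n + 1))
  have hcoz := φ.coz_eq_iSup_absGt (r := r) (fun n => by positivity)
    fun x hx => exists_nat_one_div_lt hx
  have : φ.coz = ⨆ n, d n := by
    refine le_antisymm (hcoz.le.trans (iSup_mono hd1)) (iSup_le fun n => ?_)
    rw [hcoz]
    exact le_iSup_of_le (n + 1) (hd2 n)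
  rw [this]
  exact iSup_mem_CozC hmono hd

end Separation

end PointfreeReals

theorem theorem3p1 {L : Type*} [Order.Frame L] (hL : PointfreeReals.CompletelyRegular L) :
    List.TFAE
      [PointfreeReals.StronglyZeroDimensional L,
        PointfreeReals.Coz L = PointfreeReals.CozC L,
        Nonempty (PointfreeReals.StoneCech L ≃o PointfreeReals.Banaschewski L)] := by
  tfae_have 1 → 2 := fun h => (PointfreeReals.stronglyZeroDimensional_iff.1 h).Coz_eq
  tfae_have 2 → 3 := fun h => ⟨(PointfreeReals.complementedSeparation_of_Coz_eq h).orderIso⟩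
  tfae_have 3 → 1 := fun ⟨e⟩ => PointfreeReals.Banaschewski.zeroDimensional.of_orderIso e
  tfae_finish
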